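/- Fix $\beta_\phi\in\mathbb R$. There is a constant $C>0$, depending only on $\beta_\phi$, such that the following holds for all integers $d,n\ge 0$ and $m,L\ge 1$. Let $\phi:\mathbb R\to\mathbb R$ be twice differentiable with $|\phi'|\le 1$, $|\phi''|\le\beta_\phi$ and $\phi(0)=0$, and let $\mathbf x_1,\dots,\mathbf x_n\in\mathbb R^d$ be unit vectors. For a parameter vector $\theta=(W^{(1)},\dots,W^{(L)},\mathbf v)$ with $W^{(1)}\in\mathbb R^{m\times d}$, $W^{(l)}\in\mathbb R^{m\times m}$ for $2\le l\le L$, $\mathbf v\in\mathbb R^m$, and rows $(W^{(l)}_i)^\top$ of $W^{(l)}$, the weight-normalized network (predictor) is $$\alpha^{(0)}=\mathbf x,\qquad \alpha^{(l)}_i=\phi\Big(\frac1{\sqrt m}\frac{(W^{(l)}_i)^\top\alpha^{(l-1)}}{\|W^{(l)}_i\|_2}\Big)\ (1\le i\le m,\ 1\le l\le L),\qquad f(\theta;\mathbf x)=\mathbf v^\top\alpha^{(L)}.$$ Let $\mathbf v_0\in\mathbb R^m$ with $\|\mathbf v_0\|_2=1$, let $\rho_1\in\mathbb R$, and let $\theta$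 be any parameter vector all of whose weight vectors $W^{(l)}_i$ are nonzero and with $\|\mathbf v-\mathbf v_0\|_2\le\rho_1$. Put $\|\bar W\|_2=\min_{1\le i\le m,\,1\le l\le L}\|W^{(l)}_i\|_2$. Then, for every $i\in\{1,\dots,n\}$, $f(\cdot;\mathbf x_i)$ is twice differentiable at $\theta$ and the spectral norm of its Hessian satisfies $$\big\|\nabla^2_\theta f(\theta;\mathbf x_i)\big\|_2\le C\,\frac{(1+\rho_1)L^3}{\sqrt m\,\min\{\|\bar W\|_2,\|\bar W\|_2^2\}}.$$ In particular the bound decays like $1/\sqrt m$ in the width $m$. -/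

import Mathlib

namespace WeightNorm

/-- Coordinates of the parameter vector `θ = (vec W⁽¹⁾, …, vec W⁽ᴸ⁾, v)` of a network with layer
widths `w 0, w 1, …, w L`. The layers are numbered from `0` here: the `l`-th summand (`l < L`)
indexes the entries of the matrix `W⁽ˡ⁺¹⁾` with `w (l + 1)` rows and `w l` columns;
the last summand indexes the entries of the output vector `v`. -/
abbrev ParamIdx (w : ℕ → ℕ) (L : ℕ) : Type :=
  (Σ l : Fin L, Fin (w (l + 1)) × Fin (w l)) ⊕ Fin (w L)

/-- The parameter space with its Euclidean norm. -/
abbrev Params (w : ℕ → ℕ) (L : ℕ) : Type := EuclideanSpace ℝ (ParamIdx w L)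

/-- The weight vector `W_i⁽ˡ⁺¹⁾`, the `i`-th row of the matrix `W⁽ˡ⁺¹⁾`. -/
noncomputable def row {w : ℕ → ℕ} {L : ℕ} (θ : Params w L) (l : Fin L) (i : Fin (w (l + 1))) :
    EuclideanSpace ℝ (Fin (w l)) :=
  WithLp.toLp 2 fun j => θ (Sum.inl ⟨l, (i, j)⟩)

/-- The output vector `v` of the parameter vector. -/
noncomputable def outVec {w : ℕ → ℕ} {L : ℕ} (θ : Params w L) : EuclideanSpace ℝ (Fin (w L)) :=
  WithLp.toLp 2 fun k => θ (Sum.inr k)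

/-- The vector `α⁽ˡ⁾(x)` of the activations of layer `l ≤ L`. -/
noncomputable def act {w : ℕ → ℕ} {L : ℕ} (φ : ℝ → ℝ) (θ : Params w L)
    (x : EuclideanSpace ℝ (Fin (w 0))) : (l : ℕ) → l ≤ L → EuclideanSpace ℝ (Fin (w l))
  | 0, _ => x
  | l + 1, h => WithLp.toLp 2 fun i =>
      φ (1 / √(w (l + 1) : ℝ) *
        (inner ℝ (row θ ⟨l, h⟩ i) (act φ θ x l (Nat.le_of_succ_le h)) / ‖row θ ⟨l, h⟩ i‖))

/-- The predictor `f(θ; x) = vᵀ α⁽ᴸ⁾(x)`. -/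
noncomputable def predictor {w : ℕ → ℕ} {L : ℕ} (φ : ℝ → ℝ)
    (x : EuclideanSpace ℝ (Fin (w 0))) (θ : Params w L) : ℝ :=
  inner ℝ (outVec θ) (act φ θ x L le_rfl)

/-- The minimum of the norms of all the weight vectors of the hidden layers. -/
noncomputable def minRowNorm {w : ℕ → ℕ} {L : ℕ} (θ : Params w L) : ℝ :=
  ⨅ p : (Σ l : Fin L, Fin (w (l + 1))), ‖row θ p.1 p.2‖

/-- Input dimension `d`, and all hidden layers of the same width `m`. -/
def uniformWidth (d m : ℕ) : ℕ → ℕ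
  | 0 => d
  | _ + 1 => m

/-- The activation is twice differentiable with `|φ'| ≤ 1` and `|φ''| ≤ β`. -/
structure IsSmoothActivation (φ : ℝ → ℝ) (β : ℝ) : Prop where
  differentiable : Differentiable ℝ φ
  differentiable_deriv : Differentiable ℝ (deriv φ)
  abs_deriv_le : ∀ t, |deriv φ t| ≤ 1
  abs_deriv_deriv_le : ∀ t, |deriv (deriv φ) t| ≤ β

/-- `F` is twice (Fréchet) differentiable at `θ`. -/
def TwiceDifferentiableAt {E : Type*} [NormedAddCommGroup E] [NormedSpace ℝ E]
    (F : E → ℝ) (θ : E) : Prop :=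
  (∀ᶠ η in nhds θ, DifferentiableAt ℝ F η) ∧ DifferentiableAt ℝ (fderiv ℝ F) θ

/-- The Hessian matrix of `F` at `θ`, with entries `∂²F / ∂θ_a ∂θ_b`. -/
noncomputable def hessian {ι : Type*} [Fintype ι] [DecidableEq ι]
    (F : EuclideanSpace ℝ ι → ℝ) (θ : EuclideanSpace ℝ ι) : Matrix ι ι ℝ :=
  Matrix.of fun a b =>
    fderiv ℝ (fun η => fderiv ℝ F η (EuclideanSpace.single b 1)) θ (EuclideanSpace.single a 1)

/-- The spectral norm of a matrix: its operator norm for the Euclidean norm. -/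
noncomputable def spectralNorm {ι : Type*} [Fintype ι] [DecidableEq ι] (A : Matrix ι ι ℝ) : ℝ :=
  ‖Matrix.toEuclideanCLM (n := ι) (𝕜 := ℝ) A‖

end WeightNorm

/-! The Hessian is symmetric, so its spectral norm is controlled by its quadratic form, that is, by
the second derivative at `0` of `t ↦ f(θ + t h)`. This second derivative is followed through the
layers.

The `m` normalized rows of a layer are unit vectors, so their Frobenius norm is `√m` and cancels the
factor `1/√m`. With `|φ'| ≤ 1` and `φ 0 = 0`, a layer therefore increases neither activations nor
the derivatives passed on to it. Moving the rows changes the normalized matrix only by `O(‖h‖/ω)` in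
Frobenius norm, whatever the width (`ω` is the least row norm), so each new contribution keeps its
`1/√m`. Hence the first derivative of layer `l` is `O(l‖h‖/(√m ω))`. Each layer adds
`O((1+β)L²‖h‖²/(√m ω²))` to the second derivative, whence `L³` (`exists_hasTwoJet_layer`,
`exists_hasTwoJet_act`). The linear output layer adds one cross term, of order `L‖h‖²/(√m ω)`; the
two powers of `ω` explain the minimum in the bound. -/

namespace WeightNorm

open Filter Topology

/-! ### Calculus of pointwise twice differentiability -/

section TwiceDifferentiable

variable {E F G : Type*} [NormedAddCommGroup E] [NormedSpace ℝ E]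
  [NormedAddCommGroup F] [NormedSpace ℝ F] [NormedAddCommGroup G] [NormedSpace ℝ G]

/-- `f` is differentiable near `x` and its derivative is differentiable at `x`. -/
def DiffTwiceAt (f : E → F) (x : E) : Prop :=
  (∀ᶠ y in 𝓝 x, DifferentiableAt ℝ f y) ∧ DifferentiableAt ℝ (fderiv ℝ f) x

theorem DiffTwiceAt.differentiableAt {f : E → F} {x : E} (hf : DiffTwiceAt f x) :
    DifferentiableAt ℝ f x :=
  hf.1.self_of_nhds

/-- The second derivative of the activation may be discontinuous, so the network need not be `C²`;
this weaker notion still passes through compositions. -/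
theorem DiffTwiceAt.comp {g : F → G} {f : E → F} {x : E} (hg : DiffTwiceAt g (f x))
    (hf : DiffTwiceAt f x) : DiffTwiceAt (fun y => g (f y)) x := by
  have hgf := hf.differentiableAt.continuousAt.eventually hg.1
  refine ⟨?_, ?_⟩
  · filter_upwards [hgf, hf.1] with y h₁ h₂
    exact h₁.comp y h₂
  · have h : fderiv ℝ (fun y => g (f y)) =ᶠ[𝓝 x]
        fun y => (fderiv ℝ g (f y)).comp (fderiv ℝ f y) := by
      filter_upwards [hgf, hf.1] with y h₁ h₂
      exact fderiv_comp y h₁ h₂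
    refine DifferentiableAt.congr_of_eventuallyEq ?_ h
    have hc : DifferentiableAt ℝ (fun y => fderiv ℝ g (f y)) x :=
      DifferentiableAt.comp x hg.2 hf.differentiableAt
    exact hc.clm_comp hf.2

theorem DiffTwiceAt.prodMk {f : E → F} {g : E → G} {x : E} (hf : DiffTwiceAt f x)
    (hg : DiffTwiceAt g x) : DiffTwiceAt (fun y => (f y, g y)) x := by
  refine ⟨?_, ?_⟩
  · filter_upwards [hf.1, hg.1] with y h₁ h₂
    exact h₁.prodMk h₂
  · have h : fderiv ℝ (fun y => (f y, g y)) =ᶠ[𝓝 x]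
        fun y => (ContinuousLinearMap.inl ℝ F G).comp (fderiv ℝ f y) +
          (ContinuousLinearMap.inr ℝ F G).comp (fderiv ℝ g y) := by
      filter_upwards [hf.1, hg.1] with y h₁ h₂
      rw [h₁.fderiv_prodMk h₂]
      ext v <;> simp
    refine DifferentiableAt.congr_of_eventuallyEq ?_ h
    exact ((differentiableAt_const _).clm_comp hf.2).add
      ((differentiableAt_const _).clm_comp hg.2)

theorem diffTwiceAt_of_contDiffAt {f : E → F} {x : E} (hf : ContDiffAt ℝ 2 f x) :
    DiffTwiceAt f x := by
  refine ⟨?_, ?_⟩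
  · filter_upwards [hf.eventually (by simp)] with y hy
    exact hy.differentiableAt (by simp)
  · exact (hf.fderiv_right (m := 1) (by norm_num)).differentiableAt (by simp)

theorem DiffTwiceAt.sum {ι : Type*} {f : ι → E → F} {x : E} (s : Finset ι)
    (hf : ∀ i ∈ s, DiffTwiceAt (f i) x) : DiffTwiceAt (fun y => ∑ i ∈ s, f i y) x := by
  classical
  induction s using Finset.induction_on with
  | empty => simpa using diffTwiceAt_of_contDiffAt (x := x) (contDiffAt_const (c := (0 : F)))
  | insert i s hi ih =>
    simp only [Finset.sum_insert hi]
    have hadd : DiffTwiceAt (fun p : F × F => p.1 + p.2) (f i x, ∑ j ∈ s, f j x) :=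
      diffTwiceAt_of_contDiffAt (contDiff_fst.add contDiff_snd).contDiffAt
    exact hadd.comp (f := fun y => (f i y, ∑ j ∈ s, f j y))
      ((hf i (by simp)).prodMk (ih fun j hj => hf j (by simp [hj])))

theorem diffTwiceAt_toLp {ι : Type*} [Fintype ι] {f : ι → E → ℝ} {x : E}
    (hf : ∀ i, DiffTwiceAt (f i) x) :
    DiffTwiceAt (fun y => (WithLp.toLp 2 fun i => f i y : EuclideanSpace ℝ ι)) x := by
  classical
  have h : (fun y => (WithLp.toLp 2 fun i => f i y : EuclideanSpace ℝ ι)) =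
      fun y => ∑ i, f i y • EuclideanSpace.single i (1 : ℝ) := by
    funext y
    ext j
    simp [Finset.sum_apply, Pi.single_apply]
  rw [h]
  refine DiffTwiceAt.sum _ fun i _ => ?_
  have hs : DiffTwiceAt (fun c : ℝ => c • (EuclideanSpace.single i (1 : ℝ) : EuclideanSpace ℝ ι))
      (f i x) :=
    diffTwiceAt_of_contDiffAt (contDiff_id.smul contDiff_const).contDiffAt
  exact hs.comp (hf i)

theorem IsSmoothActivation.diffTwiceAt {φ : ℝ → ℝ} {β : ℝ} (hφ : IsSmoothActivation φ β) (t : ℝ) :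
    DiffTwiceAt φ t := by
  refine ⟨Eventually.of_forall fun s => hφ.differentiable s, ?_⟩
  have h : fderiv ℝ φ = fun s => ContinuousLinearMap.toSpanSingletonCLE (𝕜 := ℝ) (deriv φ s) := by
    funext s
    ext
    simp
  rw [h]
  exact (ContinuousLinearEquiv.differentiable _).differentiableAt.comp t
    (hφ.differentiable_deriv t)

theorem DiffTwiceAt.symm {f : E → F} {x : E} (hf : DiffTwiceAt f x) (v w : E) :
    fderiv ℝ (fderiv ℝ f) x v w = fderiv ℝ (fderiv ℝ f) x w v :=
  second_derivative_symmetric_of_eventually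
    (hf.1.mono fun _ hy => hy.hasFDerivAt) hf.2.hasFDerivAt v w

end TwiceDifferentiable

/-! ### Twice differentiability of the network -/

section Network

variable {w : ℕ → ℕ} {L : ℕ}

/-- The parameters of a weight vector, as a continuous linear map. -/
noncomputable def rowCLM (l : Fin L) (i : Fin (w (l + 1))) :
    Params w L →L[ℝ] EuclideanSpace ℝ (Fin (w l)) :=
  LinearMap.toContinuousLinearMap
    { toFun := fun θ => row θ l i
      map_add' := fun _ _ => rfl
      map_smul' := fun _ _ => rfl }

/-- The output vector, as a continuous linear map. -/
noncomputable def outVecCLM : Params w L →L[ℝ] EuclideanSpace ℝ (Fin (w L)) :=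
  LinearMap.toContinuousLinearMap
    { toFun := fun θ => outVec θ
      map_add' := fun _ _ => rfl
      map_smul' := fun _ _ => rfl }

theorem diffTwiceAt_row (θ : Params w L) (l : Fin L) (i : Fin (w (l + 1))) :
    DiffTwiceAt (fun η : Params w L => row η l i) θ :=
  diffTwiceAt_of_contDiffAt (rowCLM l i).contDiff.contDiffAt

theorem diffTwiceAt_outVec (θ : Params w L) : DiffTwiceAt (fun η : Params w L => outVec η) θ :=
  diffTwiceAt_of_contDiffAt outVecCLM.contDiff.contDiffAt

theorem diffTwiceAt_act {φ : ℝ → ℝ} {β : ℝ} (hφ : IsSmoothActivation φ β) (θ : Params w L)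
    (hθ : ∀ l i, row θ l i ≠ 0) (x : EuclideanSpace ℝ (Fin (w 0))) (l : ℕ) (hl : l ≤ L) :
    DiffTwiceAt (fun η : Params w L => act φ η x l hl) θ := by
  induction l with
  | zero => exact diffTwiceAt_of_contDiffAt contDiffAt_const
  | succ l ih =>
    simp only [act]
    refine diffTwiceAt_toLp fun i => ?_
    refine (hφ.diffTwiceAt _).comp ?_
    let V := EuclideanSpace ℝ (Fin (w l))
    let G : V × V → ℝ := fun p => 1 / √(w (l + 1) : ℝ) * (inner ℝ p.1 p.2 / ‖p.1‖)
    have hG : DiffTwiceAt G (row θ ⟨l, hl⟩ i, act φ θ x l (Nat.le_of_succ_le hl)) := by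
      refine diffTwiceAt_of_contDiffAt (contDiffAt_const.mul ?_)
      refine (contDiffAt_fst.inner ℝ contDiffAt_snd).div
        (contDiffAt_fst.norm ℝ (hθ ⟨l, hl⟩ i)) ?_
      exact norm_ne_zero_iff.mpr (hθ ⟨l, hl⟩ i)
    exact hG.comp (f := fun η : Params w L =>
        (row η ⟨l, hl⟩ i, act φ η x l (Nat.le_of_succ_le hl)))
      ((diffTwiceAt_row θ ⟨l, hl⟩ i).prodMk (ih _))

theorem diffTwiceAt_predictor {φ : ℝ → ℝ} {β : ℝ} (hφ : IsSmoothActivation φ β) (θ : Params w L)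
    (hθ : ∀ l i, row θ l i ≠ 0) (x : EuclideanSpace ℝ (Fin (w 0))) :
    DiffTwiceAt (predictor φ x) θ := by
  let V := EuclideanSpace ℝ (Fin (w L))
  have hG : DiffTwiceAt (fun p : V × V => (inner ℝ p.1 p.2 : ℝ)) (outVec θ, act φ θ x L le_rfl) :=
    diffTwiceAt_of_contDiffAt (contDiffAt_fst.inner ℝ contDiffAt_snd)
  exact hG.comp (f := fun η : Params w L => (outVec η, act φ η x L le_rfl))
    ((diffTwiceAt_outVec θ).prodMk (diffTwiceAt_act hφ θ hθ x L le_rfl))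

end Network

/-! ### From the quadratic form to the spectral norm -/

section Hessian

/-- Polarization and the parallelogram law. -/
theorem abs_bilin_le_of_abs_quadratic_le {E : Type*} [NormedAddCommGroup E]
    [InnerProductSpace ℝ E] (B : E →L[ℝ] E →L[ℝ] ℝ) (hB : ∀ x y, B x y = B y x) {M : ℝ}
    (h : ∀ x, |B x x| ≤ M * ‖x‖ ^ 2) (x y : E) : |B x y| ≤ M * ‖x‖ * ‖y‖ := by
  rcases eq_or_ne x 0 with rfl | hx
  · simp
  rcases eq_or_ne y 0 with rfl | hy
  · simp
  have hx' : 0 < ‖x‖ := norm_pos_iff.mpr hx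
  have hy' : 0 < ‖y‖ := norm_pos_iff.mpr hy
  have key : ∀ a b : E, 4 * |B a b| ≤ M * (2 * ‖a‖ ^ 2 + 2 * ‖b‖ ^ 2) := by
    intro a b
    have e : 4 * B a b = B (a + b) (a + b) - B (a - b) (a - b) := by
      simp only [map_add, map_sub, add_apply, sub_apply, hB b a]
      ring
    have hp := parallelogram_law_with_norm ℝ a b
    calc 4 * |B a b| = |B (a + b) (a + b) - B (a - b) (a - b)| := by
          rw [← e, abs_mul]; norm_num
      _ ≤ |B (a + b) (a + b)| + |B (a - b) (a - b)| := abs_sub _ _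
      _ ≤ M * ‖a + b‖ ^ 2 + M * ‖a - b‖ ^ 2 := add_le_add (h _) (h _)
      _ = M * (2 * ‖a‖ ^ 2 + 2 * ‖b‖ ^ 2) := by linear_combination M * hp
  -- Both rescaled vectors have norm `‖x‖ * ‖y‖`, so the sum of squares in `key` becomes the product
  -- without loss.
  have hk := key (‖y‖ • x) (‖x‖ • y)
  simp only [map_smul, smul_apply, smul_eq_mul, norm_smul, norm_norm,
    abs_mul, abs_norm] at hk
  have hxy : 0 < ‖x‖ * ‖y‖ := mul_pos hx' hy'
  refine le_of_mul_le_mul_left ?_ hxy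
  linarith

theorem spectralNorm_hessian_le {ι : Type*} [Fintype ι] [DecidableEq ι]
    {F : EuclideanSpace ℝ ι → ℝ} {θ : EuclideanSpace ℝ ι} (hF : DiffTwiceAt F θ) {M : ℝ}
    (hM : 0 ≤ M) (h : ∀ x, |fderiv ℝ (fderiv ℝ F) θ x x| ≤ M * ‖x‖ ^ 2) :
    spectralNorm (hessian F θ) ≤ M := by
  set B := fderiv ℝ (fderiv ℝ F) θ with hBdef
  have hB := abs_bilin_le_of_abs_quadratic_le B (hF.symm) h
  have hent : ∀ a b, hessian F θ a b =
      B (EuclideanSpace.single a 1) (EuclideanSpace.single b 1) := by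
    intro a b
    simp only [hessian, Matrix.of_apply]
    rw [fderiv_clm_apply hF.2 (differentiableAt_const _)]
    simp [hBdef]
  have hsum : ∀ x : EuclideanSpace ℝ ι, x = ∑ i, x i • EuclideanSpace.single i (1 : ℝ) := by
    intro x
    ext j
    simp [Finset.sum_apply, Pi.single_apply]
  have hin : ∀ x y : EuclideanSpace ℝ ι,
      inner ℝ y (Matrix.toEuclideanCLM (n := ι) (𝕜 := ℝ) (hessian F θ) x) = B y x := by
    intro x y
    conv_rhs => rw [hsum x, hsum y]
    simp only [map_sum, map_smul, sum_apply, smul_apply,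
      smul_eq_mul, ← hent, PiLp.inner_apply, Matrix.ofLp_toEuclideanCLM, Matrix.mulVec, dotProduct]
    simp only [RCLike.inner_apply, conj_trivial, Finset.sum_mul, Finset.mul_sum]
    rw [Finset.sum_comm]
    refine Finset.sum_congr rfl fun i _ => Finset.sum_congr rfl fun j _ => ?_
    ring
  refine ContinuousLinearMap.opNorm_le_bound _ hM fun x => ?_
  set y := Matrix.toEuclideanCLM (n := ι) (𝕜 := ℝ) (hessian F θ) x with hy
  rcases eq_or_ne y 0 with h0 | h0
  · rw [h0, norm_zero]; positivity
  · have h1 : ‖y‖ * ‖y‖ = B y x := by rw [← hin x y, ← hy, real_inner_self_eq_norm_mul_norm]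
    have h2 := (le_abs_self _).trans (hB y x)
    have h3 : 0 < ‖y‖ := norm_pos_iff.mpr h0
    refine le_of_mul_le_mul_left ?_ h3
    linarith

end Hessian

/-! ### Second-order derivatives along curves -/

section TwoJet

variable {V W : Type*} [NormedAddCommGroup V] [NormedSpace ℝ V]
  [NormedAddCommGroup W] [InnerProductSpace ℝ W]

/-- The curve `g` is differentiable near `0` and twice differentiable at `0`, with derivatives
`g₁` and `g₂` there. -/
def HasTwoJet (g : ℝ → V) (g₁ g₂ : V) : Prop :=
  ∃ g' : ℝ → V, (∀ᶠ t in 𝓝 0, HasDerivAt g (g' t) t) ∧ g' 0 = g₁ ∧ HasDerivAt g' g₂ 0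

/-- Identifies the second derivative computed layer by layer with the Hessian quadratic form. -/
theorem HasTwoJet.unique {g : ℝ → V} {a₁ a₂ b₁ b₂ : V} (ha : HasTwoJet g a₁ a₂)
    (hb : HasTwoJet g b₁ b₂) : a₂ = b₂ := by
  obtain ⟨p, hp, -, hp2⟩ := ha
  obtain ⟨q, hq, -, hq2⟩ := hb
  refine (hp2.congr_of_eventuallyEq ?_).unique hq2
  filter_upwards [hp, hq] with t h₁ h₂
  exact h₂.unique h₁

theorem hasTwoJet_const (c : V) : HasTwoJet (fun _ => c) 0 0 :=
  ⟨fun _ => 0, Eventually.of_forall fun t => hasDerivAt_const t c, rfl, hasDerivAt_const 0 0⟩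

theorem hasTwoJet_line (r q : V) : HasTwoJet (fun t => r + t • q) q 0 :=
  ⟨fun _ => q, Eventually.of_forall fun t => by
    simpa using ((hasDerivAt_id t).smul_const q).const_add r, rfl, hasDerivAt_const 0 q⟩

theorem HasTwoJet.real_inner {a b : ℝ → W} {a₁ a₂ b₁ b₂ : W} (ha : HasTwoJet a a₁ a₂)
    (hb : HasTwoJet b b₁ b₂) :
    HasTwoJet (fun t => (inner ℝ (a t) (b t) : ℝ)) (inner ℝ (a 0) b₁ + inner ℝ a₁ (b 0))
      (inner ℝ (a 0) b₂ + 2 * inner ℝ a₁ b₁ + inner ℝ a₂ (b 0)) := by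
  obtain ⟨p, hp, rfl, hp2⟩ := ha
  obtain ⟨q, hq, rfl, hq2⟩ := hb
  refine ⟨fun t => inner ℝ (a t) (q t) + inner ℝ (p t) (b t), ?_, rfl, ?_⟩
  · filter_upwards [hp, hq] with t h₁ h₂
    exact h₁.inner ℝ h₂
  · have h := (hp.self_of_nhds.inner ℝ hq2).add (hp2.inner ℝ hq.self_of_nhds)
    refine h.congr_deriv ?_
    ring

theorem HasTwoJet.smul {a : ℝ → ℝ} {b : ℝ → V} {a₁ a₂ : ℝ} {b₁ b₂ : V} (ha : HasTwoJet a a₁ a₂)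
    (hb : HasTwoJet b b₁ b₂) :
    HasTwoJet (fun t => a t • b t) (a 0 • b₁ + a₁ • b 0)
      (a 0 • b₂ + (2 * a₁) • b₁ + a₂ • b 0) := by
  obtain ⟨p, hp, rfl, hp2⟩ := ha
  obtain ⟨q, hq, rfl, hq2⟩ := hb
  refine ⟨fun t => a t • q t + p t • b t, ?_, rfl, ?_⟩
  · filter_upwards [hp, hq] with t h₁ h₂
    exact h₁.smul h₂
  · have h := (hp.self_of_nhds.smul hq2).add (hp2.smul hq.self_of_nhds)
    refine h.congr_deriv ?_
    module

theorem HasTwoJet.const_mul {a : ℝ → ℝ} {a₁ a₂ : ℝ} (ha : HasTwoJet a a₁ a₂) (c : ℝ) :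
    HasTwoJet (fun t => c * a t) (c * a₁) (c * a₂) := by
  obtain ⟨p, hp, rfl, hp2⟩ := ha
  exact ⟨fun t => c * p t, hp.mono fun t h => h.const_mul c, rfl, hp2.const_mul c⟩

theorem HasTwoJet.comp_activation {φ : ℝ → ℝ} {β : ℝ} (hφ : IsSmoothActivation φ β)
    {z : ℝ → ℝ} {z₁ z₂ : ℝ} (hz : HasTwoJet z z₁ z₂) :
    HasTwoJet (fun t => φ (z t)) (deriv φ (z 0) * z₁)
      (deriv (deriv φ) (z 0) * z₁ ^ 2 + deriv φ (z 0) * z₂) := by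
  obtain ⟨p, hp, rfl, hp2⟩ := hz
  refine ⟨fun t => deriv φ (z t) * p t, ?_, rfl, ?_⟩
  · filter_upwards [hp] with t h
    exact (hφ.differentiable _).hasDerivAt.comp t h
  · have h := (((hφ.differentiable_deriv (z 0)).hasDerivAt.comp 0 hp.self_of_nhds)).mul hp2
    refine h.congr_deriv ?_
    simp only [Function.comp]
    ring

theorem hasTwoJet_toLp {ι : Type*} [Fintype ι] {g : ι → ℝ → ℝ} {g₁ g₂ : ι → ℝ}
    (hg : ∀ i, HasTwoJet (g i) (g₁ i) (g₂ i)) :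
    HasTwoJet (fun t => (WithLp.toLp 2 fun i => g i t : EuclideanSpace ℝ ι))
      (WithLp.toLp 2 g₁) (WithLp.toLp 2 g₂) := by
  choose p hp hp1 hp2 using hg
  have key : ∀ {f : ι → ℝ → ℝ} {f' : ι → ℝ} {t : ℝ}, (∀ i, HasDerivAt (f i) (f' i) t) →
      HasDerivAt (fun s => (WithLp.toLp 2 fun i => f i s : EuclideanSpace ℝ ι))
        (WithLp.toLp 2 f') t := by
    intro f f' t h
    exact ((EuclideanSpace.equiv ι ℝ).symm.hasFDerivAt
      (x := fun i => f i t)).comp_hasDerivAt t (hasDerivAt_pi.mpr h)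
  refine ⟨fun t => WithLp.toLp 2 fun i => p i t, ?_, ?_, key hp2⟩
  · filter_upwards [eventually_all.mpr hp] with t ht
    exact key ht
  · simp [hp1]

theorem hasTwoJet_inv_norm_line {r : W} (hr : r ≠ 0) (q : W) :
    ∃ v₁ v₂ : ℝ, HasTwoJet (fun t : ℝ => ‖r + t • q‖⁻¹) v₁ v₂ ∧
      |v₁| ≤ ‖q‖ / ‖r‖ ^ 2 ∧ |v₂| ≤ 3 * ‖q‖ ^ 2 / ‖r‖ ^ 3 := by
  have hline : ∀ t : ℝ, HasDerivAt (fun t : ℝ => r + t • q) q t := fun t => by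
    simpa using ((hasDerivAt_id t).smul_const q).const_add r
  have hne : ∀ᶠ t in 𝓝 (0 : ℝ), r + t • q ≠ 0 :=
    (hline 0).continuousAt.eventually_ne (by simpa using hr)
  have hnorm : ∀ t : ℝ, r + t • q ≠ 0 →
      HasDerivAt (fun t : ℝ => ‖r + t • q‖) (inner ℝ (r + t • q) q / ‖r + t • q‖) t := by
    intro t ht
    have h0 : ‖r + t • q‖ ≠ 0 := norm_ne_zero_iff.mpr ht
    have h := ((hline t).norm_sq).sqrt (by positivity)
    simp only [Real.sqrt_sq (norm_nonneg _)] at h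
    convert h using 1
    field_simp
  have hr0 : 0 < ‖r‖ := norm_pos_iff.mpr hr
  have h0 : (r + (0 : ℝ) • q) ≠ 0 := by simpa using hr
  have hin : HasDerivAt (fun t : ℝ => (inner ℝ (r + t • q) q : ℝ)) (‖q‖ ^ 2) 0 := by
    have h := (hline 0).inner ℝ (hasDerivAt_const 0 q)
    simpa [real_inner_self_eq_norm_sq] using h
  have hcs : |(inner ℝ r q : ℝ)| ≤ ‖r‖ * ‖q‖ := abs_real_inner_le_norm r q
  refine ⟨-(inner ℝ r q / ‖r‖ ^ 3), -(‖q‖ ^ 2 / ‖r‖ ^ 3) + 3 * (inner ℝ r q) ^ 2 / ‖r‖ ^ 5,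
    ⟨fun t => -(inner ℝ (r + t • q) q / ‖r + t • q‖ ^ 3), ?_, by simp, ?_⟩, ?_, ?_⟩
  · filter_upwards [hne] with t ht
    have h0 : ‖r + t • q‖ ≠ 0 := norm_ne_zero_iff.mpr ht
    refine ((hnorm t ht).inv h0).congr_deriv ?_
    field_simp
  · have h := (hin.div ((hnorm 0 h0).pow 3) (by simpa using hr0.ne')).neg
    refine h.congr_deriv ?_
    simp
    field_simp
    ring
  · rw [abs_neg, abs_div, abs_of_pos (pow_pos hr0 3), div_le_div_iff₀ (by positivity)
      (by positivity)]
    calc |(inner ℝ r q : ℝ)| * ‖r‖ ^ 2 ≤ ‖r‖ * ‖q‖ * ‖r‖ ^ 2 := by gcongr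
      _ = ‖q‖ * ‖r‖ ^ 3 := by ring
  · have h2 : (inner ℝ r q : ℝ) ^ 2 ≤ ‖r‖ ^ 2 * ‖q‖ ^ 2 := by
      rw [← mul_pow, ← sq_abs]; gcongr
    have h3 : 3 * (inner ℝ r q : ℝ) ^ 2 / ‖r‖ ^ 5 ≤ 3 * ‖q‖ ^ 2 / ‖r‖ ^ 3 := by
      rw [div_le_div_iff₀ (by positivity) (by positivity)]
      calc 3 * (inner ℝ r q : ℝ) ^ 2 * ‖r‖ ^ 3 ≤ 3 * (‖r‖ ^ 2 * ‖q‖ ^ 2) * ‖r‖ ^ 3 := by gcongr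
        _ = _ := by ring
    have h4 : 0 ≤ 3 * (inner ℝ r q : ℝ) ^ 2 / ‖r‖ ^ 5 := by positivity
    have h5 : 0 ≤ ‖q‖ ^ 2 / ‖r‖ ^ 3 := by positivity
    have h6 : 3 * ‖q‖ ^ 2 / ‖r‖ ^ 3 = 3 * (‖q‖ ^ 2 / ‖r‖ ^ 3) := by ring
    -- The two terms have opposite signs, so the constant is `3` rather than `1 + 3`.
    rw [abs_le]
    constructor <;> linarith

theorem hasTwoJet_normalized_line {r : W} (hr : r ≠ 0) (q : W) :
    ∃ u₁ u₂ : W, HasTwoJet (fun t : ℝ => ‖r + t • q‖⁻¹ • (r + t • q)) u₁ u₂ ∧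
      ‖u₁‖ ≤ 2 * ‖q‖ / ‖r‖ ∧ ‖u₂‖ ≤ 5 * ‖q‖ ^ 2 / ‖r‖ ^ 2 := by
  obtain ⟨v₁, v₂, hv, h₁, h₂⟩ := hasTwoJet_inv_norm_line hr q
  have hr0 : 0 < ‖r‖ := norm_pos_iff.mpr hr
  refine ⟨_, _, hv.smul (hasTwoJet_line r q), ?_, ?_⟩
  · simp only [zero_smul, add_zero]
    calc ‖‖r‖⁻¹ • q + v₁ • r‖ ≤ ‖r‖⁻¹ * ‖q‖ + |v₁| * ‖r‖ := by
          refine (norm_add_le _ _).trans_eq ?_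
          simp [norm_smul]
      _ ≤ ‖r‖⁻¹ * ‖q‖ + ‖q‖ / ‖r‖ ^ 2 * ‖r‖ := by gcongr
      _ = 2 * ‖q‖ / ‖r‖ := by field_simp; ring
  · simp only [zero_smul, add_zero, smul_zero, zero_add]
    calc ‖(2 * v₁) • q + v₂ • r‖ ≤ 2 * |v₁| * ‖q‖ + |v₂| * ‖r‖ := by
          refine (norm_add_le _ _).trans_eq ?_
          simp [norm_smul]
      _ ≤ 2 * (‖q‖ / ‖r‖ ^ 2) * ‖q‖ + 3 * ‖q‖ ^ 2 / ‖r‖ ^ 3 * ‖r‖ := by gcongr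
      _ = 5 * ‖q‖ ^ 2 / ‖r‖ ^ 2 := by field_simp; ring

end TwoJet

/-! ### Euclidean norms of vectors given by coordinates -/

section EuclideanBounds

variable {ι W : Type*} [Fintype ι] [NormedAddCommGroup W] [InnerProductSpace ℝ W]

theorem norm_toLp_le_of_abs_le {y z : ι → ℝ} (h : ∀ i, |y i| ≤ |z i|) :
    ‖(WithLp.toLp 2 y : EuclideanSpace ℝ ι)‖ ≤ ‖(WithLp.toLp 2 z : EuclideanSpace ℝ ι)‖ := by
  rw [EuclideanSpace.norm_eq, EuclideanSpace.norm_eq]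
  refine Real.sqrt_le_sqrt (Finset.sum_le_sum fun i _ => ?_)
  simpa using pow_le_pow_left₀ (abs_nonneg _) (h i) 2

theorem norm_toLp_inner_le {u : ι → W} {S : ℝ} (hS : 0 ≤ S) (hu : ∑ i, ‖u i‖ ^ 2 ≤ S ^ 2) (a : W) :
    ‖(WithLp.toLp 2 fun i => inner ℝ (u i) a : EuclideanSpace ℝ ι)‖ ≤ S * ‖a‖ := by
  rw [EuclideanSpace.norm_eq]
  refine Real.sqrt_le_iff.mpr ⟨by positivity, ?_⟩
  calc ∑ i, ‖(inner ℝ (u i) a : ℝ)‖ ^ 2 ≤ ∑ i, (‖u i‖ * ‖a‖) ^ 2 := by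
        gcongr with i
        exact norm_inner_le_norm _ _
    _ = (∑ i, ‖u i‖ ^ 2) * ‖a‖ ^ 2 := by simp only [mul_pow, Finset.sum_mul]
    _ ≤ S ^ 2 * ‖a‖ ^ 2 := by gcongr
    _ = (S * ‖a‖) ^ 2 := by ring

/-- The `ℓ²` norm is at most the `ℓ¹` norm. For terms quadratic in the perturbation this gives a
bound free of the width. -/
theorem norm_toLp_le_of_abs_le_sq {y s : ι → ℝ} {K : ℝ} (hK : 0 ≤ K)
    (h : ∀ i, |y i| ≤ K * s i ^ 2) :
    ‖(WithLp.toLp 2 y : EuclideanSpace ℝ ι)‖ ≤ K * ∑ i, s i ^ 2 := by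
  have hs : 0 ≤ ∑ i, s i ^ 2 := Finset.sum_nonneg fun i _ => sq_nonneg _
  rw [EuclideanSpace.norm_eq]
  refine Real.sqrt_le_iff.mpr ⟨by positivity, ?_⟩
  calc ∑ i, ‖y i‖ ^ 2 ≤ ∑ i, (K * s i ^ 2) ^ 2 := by
        gcongr with i
        exact h i
    _ ≤ (∑ i, K * s i ^ 2) ^ 2 := Finset.sum_sq_le_sq_sum_of_nonneg fun i _ => by positivity
    _ = (K * ∑ i, s i ^ 2) ^ 2 := by rw [Finset.mul_sum]

end EuclideanBounds

/-! ### One weight-normalized layer -/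

section Layer

variable {ι W : Type*} [Fintype ι] [NormedAddCommGroup W] [InnerProductSpace ℝ W]

theorem IsSmoothActivation.nonneg {φ : ℝ → ℝ} {β : ℝ} (hφ : IsSmoothActivation φ β) : 0 ≤ β :=
  (abs_nonneg _).trans (hφ.abs_deriv_deriv_le 0)

theorem IsSmoothActivation.abs_le {φ : ℝ → ℝ} {β : ℝ} (hφ : IsSmoothActivation φ β)
    (h0 : φ 0 = 0) (t : ℝ) : |φ t| ≤ |t| := by
  have h := Convex.norm_image_sub_le_of_norm_deriv_le (𝕜 := ℝ) (f := φ) (C := 1) (s := Set.univ)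
    (x := 0) (y := t) (fun x _ => hφ.differentiable x) (fun x _ => hφ.abs_deriv_le x)
    convex_univ trivial trivial
  simpa [h0] using h

theorem sum_norm_sq_normalized {r : ι → W} (hr : ∀ i, r i ≠ 0) :
    ∑ i, ‖‖r i‖⁻¹ • r i‖ ^ 2 = (√(Fintype.card ι : ℝ)) ^ 2 := by
  have h : ∀ i, ‖‖r i‖⁻¹ • r i‖ = 1 := fun i => by
    simpa using norm_smul_inv_norm (𝕜 := ℝ) (hr i)
  simp [h]

theorem norm_toLp_activation_le {φ : ℝ → ℝ} {β : ℝ} (hφ : IsSmoothActivation φ β) (h0 : φ 0 = 0)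
    [Nonempty ι] {r : ι → W} (hr : ∀ i, r i ≠ 0) (a : W) :
    ‖(WithLp.toLp 2 fun i => φ (1 / √(Fintype.card ι : ℝ) * (inner ℝ (r i) a / ‖r i‖)) :
      EuclideanSpace ℝ ι)‖ ≤ ‖a‖ := by
  have hm : 0 < √(Fintype.card ι : ℝ) := by positivity
  refine (norm_toLp_le_of_abs_le fun i => hφ.abs_le h0 _).trans ?_
  have e : (WithLp.toLp 2 fun i => 1 / √(Fintype.card ι : ℝ) * (inner ℝ (r i) a / ‖r i‖) :
      EuclideanSpace ℝ ι) = (1 / √(Fintype.card ι : ℝ)) •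
        (WithLp.toLp 2 fun i => inner ℝ (‖r i‖⁻¹ • r i) a : EuclideanSpace ℝ ι) := by
    ext i
    simp [real_inner_smul_left]
    ring
  rw [e, norm_smul, Real.norm_of_nonneg (by positivity)]
  have h := norm_toLp_inner_le hm.le (sum_norm_sq_normalized hr).le a
  calc _ ≤ 1 / √(Fintype.card ι : ℝ) * (√(Fintype.card ι : ℝ) * ‖a‖) := by gcongr
    _ = ‖a‖ := by field_simp

/-- First and second derivatives of one weight-normalized layer along a line of weight vectors. -/
theorem exists_hasTwoJet_layer {φ : ℝ → ℝ} {β : ℝ} (hφ : IsSmoothActivation φ β)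
    [Nonempty ι] {r q : ι → W} (hr : ∀ i, r i ≠ 0) {ω H A₁ A₂ : ℝ} (hω : 0 < ω)
    (hrω : ∀ i, ω ≤ ‖r i‖) (hH : 0 ≤ H) (hq : ∑ i, ‖q i‖ ^ 2 ≤ H ^ 2)
    {a : ℝ → W} {a₁ a₂ : W} (ha : HasTwoJet a a₁ a₂) (ha0 : ‖a 0‖ ≤ 1) (hA₁ : ‖a₁‖ ≤ A₁)
    (hA₂ : ‖a₂‖ ≤ A₂) :
    ∃ b₁ b₂ : EuclideanSpace ℝ ι,
      HasTwoJet (fun t : ℝ => (WithLp.toLp 2 fun i => φ (1 / √(Fintype.card ι : ℝ) *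
        (inner ℝ (r i + t • q i) (a t) / ‖r i + t • q i‖)) : EuclideanSpace ℝ ι)) b₁ b₂ ∧
      ‖b₁‖ ≤ A₁ + 2 * H / (√(Fintype.card ι : ℝ) * ω) ∧
      ‖b₂‖ ≤ β * (A₁ + 2 * H / (√(Fintype.card ι : ℝ) * ω)) ^ 2 + A₂ +
        4 * H * A₁ / (√(Fintype.card ι : ℝ) * ω) +
        5 * H ^ 2 / (√(Fintype.card ι : ℝ) * ω ^ 2) := by
  have hm : 0 < √(Fintype.card ι : ℝ) := by positivity
  set M := √(Fintype.card ι : ℝ) with hM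
  have hβ := hφ.nonneg
  choose u₁ u₂ hu hu₁ hu₂ using fun i => hasTwoJet_normalized_line (hr i) (q i)
  have hjet : ∀ i, HasTwoJet (fun t : ℝ => φ (1 / M *
        (inner ℝ (r i + t • q i) (a t) / ‖r i + t • q i‖))) _ _ := fun i => by
    have h := (((hu i).real_inner ha).const_mul (1 / M)).comp_activation hφ
    simp only [real_inner_smul_left, inv_mul_eq_div] at h
    exact h
  let u₀ : ι → W := fun i => ‖r i‖⁻¹ • r i
  let z₁ : ι → ℝ := fun i => 1 / M * (inner ℝ (u₀ i) a₁ + inner ℝ (u₁ i) (a 0))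
  let z₂ : ι → ℝ := fun i =>
    1 / M * (inner ℝ (u₀ i) a₂ + 2 * inner ℝ (u₁ i) a₁ + inner ℝ (u₂ i) (a 0))
  let ζ : ι → ℝ := fun i => 1 / M * (inner ℝ (r i) (a 0) / ‖r i‖)
  have hjet' : ∀ i, HasTwoJet (fun t : ℝ => φ (1 / M *
        (inner ℝ (r i + t • q i) (a t) / ‖r i + t • q i‖))) (deriv φ (ζ i) * z₁ i)
        (deriv (deriv φ) (ζ i) * z₁ i ^ 2 + deriv φ (ζ i) * z₂ i) := fun i => by
    convert hjet i using 1 <;> simp [ζ, z₁, z₂, u₀, real_inner_smul_left, inv_mul_eq_div]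
  have hS₁ : ∑ i, ‖u₁ i‖ ^ 2 ≤ (2 * H / ω) ^ 2 := by
    calc ∑ i, ‖u₁ i‖ ^ 2 ≤ ∑ i, (2 * ‖q i‖ / ω) ^ 2 := by
          gcongr with i
          refine (hu₁ i).trans ?_
          gcongr
          exact hrω i
      _ = (2 / ω) ^ 2 * ∑ i, ‖q i‖ ^ 2 := by
          rw [Finset.mul_sum]
          exact Finset.sum_congr rfl fun i _ => by ring
      _ ≤ (2 / ω) ^ 2 * H ^ 2 := by gcongr
      _ = (2 * H / ω) ^ 2 := by ring
  have h2H : 0 ≤ 2 * H / ω := by positivity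
  have hA₁0 : 0 ≤ A₁ := (norm_nonneg _).trans hA₁
  have hz₁ : ‖(WithLp.toLp 2 z₁ : EuclideanSpace ℝ ι)‖ ≤ A₁ + 2 * H / (M * ω) := by
    have e : (WithLp.toLp 2 z₁ : EuclideanSpace ℝ ι) = (1 / M) •
        ((WithLp.toLp 2 fun i => inner ℝ (u₀ i) a₁) +
          (WithLp.toLp 2 fun i => inner ℝ (u₁ i) (a 0))) := by
      ext i
      simp [z₁]
      ring
    rw [e, norm_smul, Real.norm_of_nonneg (by positivity)]
    -- Only the unit rows `u₀` have Frobenius norm `M`; the bound for `u₁` is free of the width, so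
    -- its term keeps `1 / M`.
    calc _ ≤ 1 / M * (M * A₁ + 2 * H / ω * 1) := by
          gcongr
          refine (norm_add_le _ _).trans (add_le_add ?_ ?_)
          · exact (norm_toLp_inner_le hm.le (sum_norm_sq_normalized hr).le a₁).trans (by gcongr)
          · exact (norm_toLp_inner_le h2H hS₁ (a 0)).trans (by gcongr)
      _ = A₁ + 2 * H / (M * ω) := by field_simp
  have hu₂' : ‖(WithLp.toLp 2 fun i => inner ℝ (u₂ i) (a 0) : EuclideanSpace ℝ ι)‖ ≤
      5 / ω ^ 2 * H ^ 2 := by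
    refine (norm_toLp_le_of_abs_le_sq (K := 5 / ω ^ 2) (s := fun i => ‖q i‖) (by positivity)
      fun i => ?_).trans (by gcongr)
    calc |(inner ℝ (u₂ i) (a 0) : ℝ)| ≤ ‖u₂ i‖ * ‖a 0‖ := abs_real_inner_le_norm _ _
      _ ≤ 5 * ‖q i‖ ^ 2 / ‖r i‖ ^ 2 * 1 := by gcongr; exact hu₂ i
      _ ≤ 5 * ‖q i‖ ^ 2 / ω ^ 2 * 1 := by gcongr; exact hrω i
      _ = 5 / ω ^ 2 * ‖q i‖ ^ 2 := by ring
  have hz₂ : ‖(WithLp.toLp 2 z₂ : EuclideanSpace ℝ ι)‖ ≤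
      A₂ + 4 * H * A₁ / (M * ω) + 5 * H ^ 2 / (M * ω ^ 2) := by
    have e : (WithLp.toLp 2 z₂ : EuclideanSpace ℝ ι) = (1 / M) •
        ((WithLp.toLp 2 fun i => inner ℝ (u₀ i) a₂) +
          (2 : ℝ) • (WithLp.toLp 2 fun i => inner ℝ (u₁ i) a₁) +
          (WithLp.toLp 2 fun i => inner ℝ (u₂ i) (a 0))) := by
      ext i
      simp [z₂]
      ring
    rw [e, norm_smul, Real.norm_of_nonneg (by positivity)]
    calc _ ≤ 1 / M * (M * A₂ + 2 * (2 * H / ω * A₁) + 5 / ω ^ 2 * H ^ 2) := by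
          gcongr
          refine (norm_add₃_le).trans (add_le_add (add_le_add ?_ ?_) hu₂')
          · exact (norm_toLp_inner_le hm.le (sum_norm_sq_normalized hr).le a₂).trans (by gcongr)
          · rw [norm_smul, Real.norm_of_nonneg (by norm_num)]
            gcongr
            exact (norm_toLp_inner_le h2H hS₁ a₁).trans (by gcongr)
      _ = _ := by field_simp; ring
  have hφ' : ∀ (s : ℝ) (y : ℝ), |deriv φ s * y| ≤ |y| := fun s y => by
    rw [abs_mul]
    exact mul_le_of_le_one_left (abs_nonneg _) (hφ.abs_deriv_le s)
  refine ⟨_, _, hasTwoJet_toLp hjet', ?_, ?_⟩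
  · exact (norm_toLp_le_of_abs_le fun i => hφ' _ _).trans hz₁
  · have e : (WithLp.toLp 2 fun i => deriv (deriv φ) (ζ i) * z₁ i ^ 2 + deriv φ (ζ i) * z₂ i :
        EuclideanSpace ℝ ι) = (WithLp.toLp 2 fun i => deriv (deriv φ) (ζ i) * z₁ i ^ 2) +
          (WithLp.toLp 2 fun i => deriv φ (ζ i) * z₂ i) := rfl
    have hsq : ‖(WithLp.toLp 2 fun i => deriv (deriv φ) (ζ i) * z₁ i ^ 2 :
        EuclideanSpace ℝ ι)‖ ≤ β * (A₁ + 2 * H / (M * ω)) ^ 2 := by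
      refine (norm_toLp_le_of_abs_le_sq hβ (s := z₁) fun i => ?_).trans ?_
      · rw [abs_mul, abs_of_nonneg (sq_nonneg (z₁ i))]
        gcongr
        exact hφ.abs_deriv_deriv_le _
      · have : ∑ i, z₁ i ^ 2 = ‖(WithLp.toLp 2 z₁ : EuclideanSpace ℝ ι)‖ ^ 2 := by
          simp [EuclideanSpace.norm_sq_eq]
        rw [this]
        gcongr
    rw [e]
    calc _ ≤ β * (A₁ + 2 * H / (M * ω)) ^ 2 +
          (A₂ + 4 * H * A₁ / (M * ω) + 5 * H ^ 2 / (M * ω ^ 2)) :=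
          (norm_add_le _ _).trans (add_le_add hsq
            ((norm_toLp_le_of_abs_le fun i => hφ' _ _).trans hz₂))
      _ = _ := by ring

end Layer

/-! ### Induction over the layers -/

section NetworkBounds

variable {w : ℕ → ℕ} {L : ℕ}

theorem sum_norm_sq_row_le (h : Params w L) (l : Fin L) :
    ∑ i, ‖row h l i‖ ^ 2 ≤ ‖h‖ ^ 2 := by
  simp only [EuclideanSpace.norm_sq_eq, row]
  rw [Fintype.sum_sum_type, Fintype.sum_sigma]
  refine le_add_of_le_of_nonneg ?_ (by positivity)
  rw [← Fintype.sum_prod_type' (f := fun i j => ‖h (Sum.inl ⟨l, (i, j)⟩)‖ ^ 2)]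
  exact Finset.single_le_sum
    (f := fun l => ∑ p : Fin (w (l.1 + 1)) × Fin (w l.1), ‖h (Sum.inl ⟨l, p⟩)‖ ^ 2)
    (fun _ _ => by positivity) (Finset.mem_univ l)

theorem norm_outVec_le (h : Params w L) : ‖outVec h‖ ≤ ‖h‖ := by
  refine le_of_sq_le_sq ?_ (norm_nonneg _)
  simp only [EuclideanSpace.norm_sq_eq, outVec]
  rw [Fintype.sum_sum_type]
  exact le_add_of_nonneg_left (by positivity)

theorem norm_act_le {φ : ℝ → ℝ} {β : ℝ} (hφ : IsSmoothActivation φ β) (h0 : φ 0 = 0)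
    (hw : ∀ l, 0 < w (l + 1)) (θ : Params w L) (hθ : ∀ l i, row θ l i ≠ 0)
    (x : EuclideanSpace ℝ (Fin (w 0))) (l : ℕ) (hl : l ≤ L) : ‖act φ θ x l hl‖ ≤ ‖x‖ := by
  induction l with
  | zero => exact le_rfl
  | succ l ih =>
    have : Nonempty (Fin (w (l + 1))) := ⟨⟨0, hw l⟩⟩
    have h := norm_toLp_activation_le hφ h0 (hθ ⟨l, hl⟩) (act φ θ x l (Nat.le_of_succ_le hl))
    rw [Fintype.card_fin] at h
    exact h.trans (ih _)

/-- The second-order bound carries `L ^ 2` instead of a power of `l`, so that every layer adds the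
same increment. -/
theorem exists_hasTwoJet_act {φ : ℝ → ℝ} {β : ℝ} (hφ : IsSmoothActivation φ β) (h0 : φ 0 = 0)
    {m : ℕ} (hm : 0 < m) (hw : ∀ l, w (l + 1) = m) (θ h : Params w L)
    (hθ : ∀ l i, row θ l i ≠ 0) {ω : ℝ} (hω : 0 < ω) (hθω : ∀ l i, ω ≤ ‖row θ l i‖)
    {x : EuclideanSpace ℝ (Fin (w 0))} (hx : ‖x‖ = 1) (l : ℕ) (hl : l ≤ L) :
    ∃ a₁ a₂ : EuclideanSpace ℝ (Fin (w l)),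
      HasTwoJet (fun t : ℝ => act φ (θ + t • h) x l hl) a₁ a₂ ∧
      ‖a₁‖ ≤ l * (2 * ‖h‖ / (√(m : ℝ) * ω)) ∧
      ‖a₂‖ ≤ (l : ℝ) * ((4 * β + 8) * L ^ 2 * (‖h‖ ^ 2 / (√(m : ℝ) * ω ^ 2))) := by
  induction l with
  | zero => exact ⟨0, 0, hasTwoJet_const x, by simp, by simp⟩
  | succ l ih =>
    obtain ⟨a₁, a₂, ha, h₁, h₂⟩ := ih (Nat.le_of_succ_le hl)
    have : Nonempty (Fin (w (l + 1))) := ⟨⟨0, by rw [hw]; exact hm⟩⟩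
    have ha0 : ‖act φ (θ + (0 : ℝ) • h) x l (Nat.le_of_succ_le hl)‖ ≤ 1 := by
      rw [zero_smul, add_zero, ← hx]
      exact norm_act_le hφ h0 (fun l => by rw [hw]; exact hm) θ hθ x l _
    obtain ⟨b₁, b₂, hb, hb₁, hb₂⟩ := exists_hasTwoJet_layer hφ (hθ ⟨l, hl⟩) hω (hθω ⟨l, hl⟩)
      (norm_nonneg h) (sum_norm_sq_row_le h ⟨l, hl⟩) ha ha0 h₁ h₂
    simp only [Fintype.card_fin] at hb hb₁ hb₂
    have hMw : √(w (l + 1) : ℝ) = √(m : ℝ) := by rw [hw]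
    refine ⟨b₁, b₂, hb, ?_, ?_⟩
    · rw [hMw] at hb₁
      push_cast
      linarith
    · rw [hMw] at hb₂
      have hM : 1 ≤ √(m : ℝ) := by
        rw [Real.one_le_sqrt]
        exact_mod_cast hm
      have hβ := hφ.nonneg
      set M := √(m : ℝ)
      set Q := ‖h‖ ^ 2 / (M * ω ^ 2) with hQ
      have hQ0 : 0 ≤ Q := by positivity
      -- Since `M ≥ 1`, one of the two factors `1 / M` is given up here.
      have hS : (‖h‖ / (M * ω)) ^ 2 ≤ Q := by
        rw [hQ, div_pow]
        gcongr
        rw [mul_pow]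
        gcongr
        nlinarith
      have hl' : (l : ℝ) + 1 ≤ L := by exact_mod_cast hl
      have hl0 : (0 : ℝ) ≤ l := by positivity
      have hL2 : ((l : ℝ) + 1) ^ 2 ≤ (L : ℝ) ^ 2 := by gcongr
      have e₁ : (l : ℝ) * (2 * ‖h‖ / (M * ω)) + 2 * ‖h‖ / (M * ω) =
          2 * (l + 1) * (‖h‖ / (M * ω)) := by ring
      have e₂ : 4 * ‖h‖ * (l * (2 * ‖h‖ / (M * ω))) / (M * ω) = 8 * l * (‖h‖ / (M * ω)) ^ 2 := by
        ring
      have e₃ : 5 * ‖h‖ ^ 2 / (M * ω ^ 2) = 5 * Q := by rw [hQ]; ring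
      rw [e₁, e₂, e₃, mul_pow, mul_pow] at hb₂
      have k₁ : β * (2 ^ 2 * ((l : ℝ) + 1) ^ 2 * (‖h‖ / (M * ω)) ^ 2) ≤
          β * (2 ^ 2 * (L : ℝ) ^ 2 * Q) := by gcongr
      have k₂ : 8 * (l : ℝ) * (‖h‖ / (M * ω)) ^ 2 ≤ 8 * l * Q := by gcongr
      -- From `l + 1 ≤ L`: `8l + 5 ≤ 8(l + 1)²`. This is the `8` in `4 * β + 8`; the `4 * β` is
      -- `k₁`.
      have k₃ : (8 * (l : ℝ) + 5) * Q ≤ 8 * (L : ℝ) ^ 2 * Q := by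
        gcongr
        nlinarith
      push_cast
      linarith

end NetworkBounds

/-! ### The Hessian quadratic form of the predictor -/

theorem DiffTwiceAt.hasTwoJet_line {E : Type*} [NormedAddCommGroup E] [NormedSpace ℝ E]
    {f : E → ℝ} {x : E} (hf : DiffTwiceAt f x) (v : E) :
    HasTwoJet (fun t : ℝ => f (x + t • v)) (fderiv ℝ f x v) (fderiv ℝ (fderiv ℝ f) x v v) := by
  have hline : ∀ t : ℝ, HasDerivAt (fun t : ℝ => x + t • v) v t := fun t => by
    simpa using ((hasDerivAt_id t).smul_const v).const_add x
  have hx : x + (0 : ℝ) • v = x := by simp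
  refine ⟨fun t => fderiv ℝ f (x + t • v) v, ?_, by simp, ?_⟩
  · have hc : Tendsto (fun t : ℝ => x + t • v) (𝓝 0) (𝓝 x) := by
      simpa using (hline 0).continuousAt.tendsto
    filter_upwards [hc.eventually hf.1] with t ht
    exact ht.hasFDerivAt.comp_hasDerivAt t (hline t)
  · have h : HasFDerivAt (fderiv ℝ f) (fderiv ℝ (fderiv ℝ f) x) (x + (0 : ℝ) • v) := by
      rw [hx]; exact hf.2.hasFDerivAt
    exact (ContinuousLinearMap.apply ℝ ℝ v).hasFDerivAt.comp_hasDerivAt 0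
      (h.comp_hasDerivAt 0 (hline 0))

theorem abs_second_deriv_predictor_le {w : ℕ → ℕ} {L : ℕ} {φ : ℝ → ℝ} {β : ℝ}
    (hφ : IsSmoothActivation φ β) (h0 : φ 0 = 0) {m : ℕ} (hm : 0 < m)
    (hw : ∀ l, w (l + 1) = m) (θ h : Params w L)
    (hθ : ∀ l i, row θ l i ≠ 0) {ω : ℝ} (hω : 0 < ω) (hθω : ∀ l i, ω ≤ ‖row θ l i‖)
    {x : EuclideanSpace ℝ (Fin (w 0))} (hx : ‖x‖ = 1) :
    |fderiv ℝ (fderiv ℝ (predictor φ x)) θ h h| ≤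
      4 * L * ‖h‖ ^ 2 / (√(m : ℝ) * ω) +
        ‖outVec θ‖ * ((4 * β + 8) * L ^ 3 * (‖h‖ ^ 2 / (√(m : ℝ) * ω ^ 2))) := by
  obtain ⟨a₁, a₂, ha, h₁, h₂⟩ := exists_hasTwoJet_act hφ h0 hm hw θ h hθ hω hθω hx L le_rfl
  have hv : HasTwoJet (fun t : ℝ => outVec (θ + t • h)) (outVec h) 0 :=
    WeightNorm.hasTwoJet_line (outVec θ) (outVec h)
  have e := ((diffTwiceAt_predictor hφ θ hθ x).hasTwoJet_line h).unique (hv.real_inner ha)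
  rw [e]
  simp only [zero_smul, add_zero, inner_zero_left]
  have k₁ : |(inner ℝ (outVec h) a₁ : ℝ)| ≤ ‖h‖ * (L * (2 * ‖h‖ / (√(m : ℝ) * ω))) := by
    refine (abs_real_inner_le_norm _ _).trans ?_
    gcongr
    exact norm_outVec_le h
  have k₂ : |(inner ℝ (outVec θ) a₂ : ℝ)| ≤
      ‖outVec θ‖ * (L * ((4 * β + 8) * L ^ 2 * (‖h‖ ^ 2 / (√(m : ℝ) * ω ^ 2)))) := by
    refine (abs_real_inner_le_norm _ _).trans ?_
    gcongr
  calc _ ≤ |(inner ℝ (outVec θ) a₂ : ℝ)| + 2 * |(inner ℝ (outVec h) a₁ : ℝ)| := by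
        refine (abs_add_le _ _).trans_eq ?_
        rw [abs_mul, abs_two]
    _ ≤ _ := add_le_add k₂ (mul_le_mul_of_nonneg_left k₁ zero_le_two)
    _ = _ := by ring

theorem minRowNorm_le {w : ℕ → ℕ} {L : ℕ} (θ : Params w L) (l : Fin L) (i : Fin (w (l + 1))) :
    minRowNorm θ ≤ ‖row θ l i‖ :=
  ciInf_le (f := fun p : (Σ l : Fin L, Fin (w (l + 1))) => ‖row θ p.1 p.2‖)
    (Set.finite_range _).bddBelow ⟨l, i⟩

theorem minRowNorm_pos {w : ℕ → ℕ} {L : ℕ} (hL : 0 < L) (hw : ∀ l, 0 < w (l + 1))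
    (θ : Params w L) (hθ : ∀ l i, row θ l i ≠ 0) : 0 < minRowNorm θ := by
  -- Needed because the infimum of an empty family of reals is `0`.
  have : Nonempty (Σ l : Fin L, Fin (w (l + 1))) := ⟨⟨⟨0, hL⟩, ⟨0, hw _⟩⟩⟩
  obtain ⟨p, hp⟩ := exists_eq_ciInf_of_finite
    (f := fun p : (Σ l : Fin L, Fin (w (l + 1))) => ‖row θ p.1 p.2‖)
  rw [minRowNorm, ← hp]
  exact norm_pos_iff.mpr (hθ _ _)

end WeightNorm

/-! ### The Hessian bound -/

theorem mainTheorem2 (β : ℝ) :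
    ∃ C : ℝ, 0 < C ∧
      ∀ (d m L n : ℕ), 1 ≤ m → 1 ≤ L →
      ∀ (φ : ℝ → ℝ), WeightNorm.IsSmoothActivation φ β → φ 0 = 0 →
      ∀ (x : Fin n → EuclideanSpace ℝ (Fin (WeightNorm.uniformWidth d m 0))), (∀ i, ‖x i‖ = 1) →
      ∀ (v₀ : EuclideanSpace ℝ (Fin (WeightNorm.uniformWidth d m L))), ‖v₀‖ = 1 →
      ∀ (ρ₁ : ℝ) (θ : WeightNorm.Params (WeightNorm.uniformWidth d m) L),
        (∀ l i, WeightNorm.row θ l i ≠ 0) →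
        WeightNorm.outVec θ ∈ Metric.closedBall v₀ ρ₁ →
        ∀ i : Fin n,
          WeightNorm.TwiceDifferentiableAt (WeightNorm.predictor φ (x i)) θ ∧
          WeightNorm.spectralNorm (WeightNorm.hessian (WeightNorm.predictor φ (x i)) θ) ≤
            C * ((1 + ρ₁) * (L : ℝ) ^ 3 /
              (√(m : ℝ) * min (WeightNorm.minRowNorm θ) (WeightNorm.minRowNorm θ ^ 2))) := by
  -- `12 = 4 + 8`: `4` from the output cross term, `4β + 8` from the hidden layers. The absolute
  -- value keeps `C` positive for negative `β`, for which no activation exists.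
  refine ⟨4 * |β| + 12, by positivity, ?_⟩
  intro d m L n hm hL φ hφ h0 x hx v₀ hv₀ ρ₁ θ hθ hv i
  have htd := WeightNorm.diffTwiceAt_predictor hφ θ hθ (x i)
  refine ⟨htd, ?_⟩
  -- A closed ball with a point in it has nonnegative radius.
  have hρ : 0 ≤ ρ₁ := dist_nonneg.trans (Metric.mem_closedBall.mp hv)
  have hvn : ‖WeightNorm.outVec θ‖ ≤ 1 + ρ₁ := by
    rw [mem_closedBall_iff_norm] at hv
    have := norm_le_norm_add_norm_sub' (WeightNorm.outVec θ) v₀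
    linarith
  have hω := WeightNorm.minRowNorm_pos hL (fun _ => hm) θ hθ
  have hθω := WeightNorm.minRowNorm_le θ
  set ω := WeightNorm.minRowNorm θ
  have hM : 0 < √(m : ℝ) := Real.sqrt_pos.mpr (by exact_mod_cast hm)
  have hmin : 0 < min ω (ω ^ 2) := lt_min hω (by positivity)
  refine WeightNorm.spectralNorm_hessian_le htd (by positivity) fun h => ?_
  refine (WeightNorm.abs_second_deriv_predictor_le hφ h0 hm (fun _ => rfl) θ h hθ hω hθω
    (hx i)).trans ?_
  have hβ := hφ.nonneg
  rw [abs_of_nonneg hβ]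
  set q := ‖h‖ ^ 2 / (√(m : ℝ) * min ω (ω ^ 2)) with hq
  have hq0 : 0 ≤ q := by positivity
  have q₁ : ‖h‖ ^ 2 / (√(m : ℝ) * ω) ≤ q := by
    rw [hq]; gcongr; exact min_le_left _ _
  have q₂ : ‖h‖ ^ 2 / (√(m : ℝ) * ω ^ 2) ≤ q := by
    rw [hq]; gcongr; exact min_le_right _ _
  have hL1 : (1 : ℝ) ≤ L := by exact_mod_cast hL
  have hL3 : (L : ℝ) ≤ L ^ 3 := le_self_pow₀ hL1 (by norm_num)
  have hρL : (L : ℝ) ≤ (1 + ρ₁) * L ^ 3 := by nlinarith [mul_nonneg hρ (hL3.trans' (by positivity))]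
  calc 4 * L * ‖h‖ ^ 2 / (√(m : ℝ) * ω) + ‖WeightNorm.outVec θ‖ *
        ((4 * β + 8) * L ^ 3 * (‖h‖ ^ 2 / (√(m : ℝ) * ω ^ 2)))
      = 4 * L * (‖h‖ ^ 2 / (√(m : ℝ) * ω)) + ‖WeightNorm.outVec θ‖ *
        ((4 * β + 8) * L ^ 3 * (‖h‖ ^ 2 / (√(m : ℝ) * ω ^ 2))) := by ring
    _ ≤ 4 * ((1 + ρ₁) * L ^ 3) * q + (1 + ρ₁) * ((4 * β + 8) * L ^ 3 * q) := by gcongr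
    _ = _ := by rw [hq]; ring
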